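/- Let $M,N$ be nonnegative integers, $\beta\ge 0$, and for $i,j\in\{1,2\}$ let $P_i\ge 0$, $\eta_{ij}>0$ and $\boldsymbol H_{ij}\in\mathbb C^{N\times M}$, where $\boldsymbol H_{12}\neq 0$ and $\boldsymbol H_{21}\neq 0$. Consider the MIMO full-duplex two-way channel with these data, viewed as the following two-player game. Throughout, $j$ denotes the index in $\{1,2\}$ different from $i$. A strategy of node $i$ is an element of $$\mathcal X_i=\{\boldsymbol Q\in\mathbb C^{M\times M}:\ \boldsymbol Q\succeq 0,\ \operatorname{tr}\boldsymbol Q\le P_i\},$$ and the payoff of node $i$ is $$R_i(\boldsymbol Q_i,\boldsymbol Q_j)=\log\det\!\left(\boldsymbol I+\eta_{ij}\boldsymbol H_{ij}^{\dagger}\boldsymbol\Sigma_j^{-1}\boldsymbol H_{ij}\boldsymbol Q_i\right),\qquad \boldsymbol\Sigma_j=\boldsymbol I+\beta\eta_{jj}\boldsymbol H_{jj}\,\mathrm{diag}(\boldsymbol Q_j)\,\boldsymbol H_{jj}^{\dagger},$$ where $\mathrm{diag}(\boldsymbol Q)$ is the diagonal matrix with the diagonal of $\boldsymbol Q$. A Nash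 equilibrium is a pair $(\boldsymbol Q_1^*,\boldsymbol Q_2^*)\in\mathcal X_1\times\mathcal X_2$ with $R_i(\boldsymbol Q_i^*,\boldsymbol Q_j^*)\ge R_i(\boldsymbol Q_i,\boldsymbol Q_j^*)$ for $i=1,2$ and all $\boldsymbol Q_i\in\mathcal X_i$. Put $\gamma_i=\eta_{ji}/\eta_{ii}$, let $\rho$ denote the spectral radius, $\boldsymbol A^{-1}$ the Moore--Penrose generalized inverse of a matrix $\boldsymbol A$ and $\boldsymbol A^{-\dagger}=(\boldsymbol A^{-1})^{\dagger}$, and define $$\alpha_i=\begin{cases}\dfrac{\beta}{\gamma_i}\,\rho\!\left(\boldsymbol H_{ii}^{\dagger}\boldsymbol H_{ji}^{-\dagger}\boldsymbol H_{ji}^{-1}\boldsymbol H_{ii}\right) & \text{if } \operatorname{rank}\boldsymbol H_{ji}=N,\\[2ex] \dfrac{\beta}{\gamma_i}\left(1+\beta\eta_{ii}P_i\,\rho(\boldsymbol H_{ii}^{\dagger}\boldsymbol H_{ii})\right)\rho(\boldsymbol H_{ii}^{\dagger}\boldsymbol H_{ii})\,\rho(\boldsymbol H_{ji}^{-\dagger}\boldsymbol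 H_{ji}^{-1}) & \text{otherwise.}\end{cases}$$ If $\alpha_1\alpha_2<1$, then the channel has exactly one Nash equilibrium. Moreover, in this case every $\boldsymbol Q_j\in\mathcal X_j$ has exactly one best response $\mathcal B_i(\boldsymbol Q_j)$, i.e. exactly one maximizer of $R_i(\cdot,\boldsymbol Q_j)$ over $\mathcal X_i$, for $i=1,2$, and the mapping $\boldsymbol\Phi(\boldsymbol Q_1,\boldsymbol Q_2)=(\mathcal B_1(\boldsymbol Q_2),\mathcal B_2(\boldsymbol Q_1))$ is a contraction of $\mathcal X_1\times\mathcal X_2$ with respect to the weighted-maximum norm $\|(\boldsymbol X_1,\boldsymbol X_2)\|_F^{\boldsymbol w}=\max_{i}\|\boldsymbol X_i\|_F/w_i$ for some $w_1,w_2>0$: there is $\kappa\in[0,1)$ such that $\|\boldsymbol\Phi(\boldsymbol Q)-\boldsymbol\Phi(\boldsymbol Q')\|_F^{\boldsymbol w}\le\kappa\|\boldsymbol Q-\boldsymbol Q'\|_F^{\boldsymbol w}$ for all $\boldsymbol Q,\boldsymbol Q'\in\mathcal X_1\times\mathcal X_2$. -/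

import Mathlib

open scoped Matrix ComplexOrder

namespace FullDuplex

section LinearAlgebra

variable {m n : Type*} [Fintype m] [Fintype n]

/-- The four Penrose equations: `X` is the Moore-Penrose generalized inverse of the complex
matrix `A`. -/
structure IsMoorePenrose (A : Matrix m n ℂ) (X : Matrix n m ℂ) : Prop where
  mul_mul_self : A * X * A = A
  self_mul_mul : X * A * X = X
  isHermitian_left : (A * X).IsHermitian
  isHermitian_right : (X * A).IsHermitian

/-- Uniqueness of the Moore-Penrose generalized inverse. -/
theorem IsMoorePenrose.unique {A : Matrix m n ℂ} {X Y : Matrix n m ℂ}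
    (hX : IsMoorePenrose A X) (hY : IsMoorePenrose A Y) : X = Y := by
  have h1 : A * X = A * Y := by
    calc A * X = (A * X)ᴴ := hX.isHermitian_left.eq.symm
      _ = (A * Y * A * X)ᴴ := by rw [hY.mul_mul_self]
      _ = (A * X)ᴴ * (A * Y)ᴴ := by
        rw [← Matrix.conjTranspose_mul, Matrix.mul_assoc (A * Y) A X]
      _ = A * X * (A * Y) := by rw [hX.isHermitian_left.eq, hY.isHermitian_left.eq]
      _ = A * X * A * Y := by simp only [Matrix.mul_assoc]
      _ = A * Y := by rw [hX.mul_mul_self]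
  have h2 : X * A = Y * A := by
    calc X * A = (X * A)ᴴ := hX.isHermitian_right.eq.symm
      _ = (X * (A * Y * A))ᴴ := by rw [hY.mul_mul_self]
      _ = (Y * A)ᴴ * (X * A)ᴴ := by
        rw [← Matrix.conjTranspose_mul]; simp only [Matrix.mul_assoc]
      _ = Y * A * (X * A) := by rw [hX.isHermitian_right.eq, hY.isHermitian_right.eq]
      _ = Y * (A * X * A) := by simp only [Matrix.mul_assoc]
      _ = Y * A := by rw [hX.mul_mul_self]
  calc X = X * A * X := hX.self_mul_mul.symm
    _ = Y * (A * X) := by rw [h2, Matrix.mul_assoc]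
    _ = Y * A * Y := by rw [h1, Matrix.mul_assoc]
    _ = Y := hY.self_mul_mul

/-- Every complex matrix has a Moore-Penrose generalized inverse. -/
theorem exists_isMoorePenrose (A : Matrix m n ℂ) : ∃ X, IsMoorePenrose A X := by
  classical
  set B : Matrix n n ℂ := Aᴴ * A with hB
  have hBh : IsSelfAdjoint B := Matrix.isHermitian_conjTranspose_mul_self A
  set C : Matrix n n ℂ := cfc (fun x : ℝ => x⁻¹) B with hC
  have hCh : Cᴴ = C := (cfc_predicate (R := ℝ) (fun x : ℝ => x⁻¹) B : IsSelfAdjoint _)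
  have hcont : ∀ f : ℝ → ℝ, ContinuousOn f (spectrum ℝ B) := fun f =>
    (Matrix.finite_spectrum B |>.preimage
      (FaithfulSMul.algebraMap_injective ℝ ℂ).injOn |>.subset (by
        intro x hx
        exact (spectrum.algebraMap_mem_iff ℂ).mpr hx)).continuousOn f
  have hid : cfc (fun x : ℝ => x) B = B := cfc_id' ℝ B
  have hCB : C * B = cfc (fun x : ℝ => x⁻¹ * x) B := by
    rw [cfc_mul _ _ B (hcont _) (hcont _), hid]
  have hBC : B * C = C * B := by
    rw [hCB, show (fun x : ℝ => x⁻¹ * x) = fun x => x * x⁻¹ from funext fun x => mul_comm _ _,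
      cfc_mul _ _ B (hcont _) (hcont _), hid]
  have hBCB : B * (C * B) = B := by
    conv_lhs => rw [hCB, ← hid, hid]
    nth_rewrite 1 [← hid]
    rw [← cfc_mul _ _ B (hcont _) (hcont _)]
    conv_rhs => rw [← hid]
    congr 1; funext x
    rcases eq_or_ne x 0 with rfl | hx
    · simp
    · field_simp
  have hCBC : C * B * C = C := by
    rw [hCB, hC, ← cfc_mul _ _ B (hcont _) (hcont _)]
    congr 1; funext x
    rcases eq_or_ne x 0 with rfl | hx
    · simp
    · field_simp
  have hA : A * (C * B) = A := by
    have h0 : A * (C * B) - A = 0 := by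
      rw [← Matrix.conjTranspose_mul_self_eq_zero]
      have e : (A * (C * B) - A)ᴴ * (A * (C * B) - A)
          = (C * B)ᴴ * (B * (C * B)) - (C * B)ᴴ * B - (B * (C * B) - B) := by
        rw [Matrix.conjTranspose_sub, Matrix.conjTranspose_mul]
        simp only [hB, Matrix.sub_mul, Matrix.mul_sub, Matrix.mul_assoc]
        abel
      rw [e, hBCB]; simp
    exact sub_eq_zero.mp h0
  have hXA : C * Aᴴ * A = C * B := by rw [Matrix.mul_assoc]
  refine ⟨C * Aᴴ, ?_, ?_, ?_, ?_⟩
  · rw [Matrix.mul_assoc, hXA, hA]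
  · rw [hXA, ← Matrix.mul_assoc, hCBC]
  · unfold Matrix.IsHermitian
    simp only [Matrix.conjTranspose_mul, Matrix.conjTranspose_conjTranspose, hCh, Matrix.mul_assoc]
  · unfold Matrix.IsHermitian
    have hBh' : Bᴴ = B := hBh
    rw [hXA, Matrix.conjTranspose_mul, hCh, hBh', hBC]

/-- The Moore-Penrose generalized inverse of a complex matrix. -/
noncomputable def pinv (A : Matrix m n ℂ) : Matrix n m ℂ :=
  Classical.choose (exists_isMoorePenrose A)

theorem pinv_spec (A : Matrix m n ℂ) : IsMoorePenrose A (pinv A) :=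
  Classical.choose_spec (exists_isMoorePenrose A)

/-- The spectral radius of a square complex matrix, as a real number (the largest modulus of an
eigenvalue). -/
noncomputable def rho [DecidableEq n] (A : Matrix n n ℂ) : ℝ := (spectralRadius ℂ A).toReal

/-- The Frobenius norm of a complex matrix. -/
noncomputable def frobNorm (A : Matrix m n ℂ) : ℝ :=
  letI : NormedAddCommGroup (Matrix m n ℂ) := Matrix.frobeniusNormedAddCommGroup
  ‖A‖

end LinearAlgebra

/-- The other node. -/
def other (i : Fin 2) : Fin 2 := 1 - i

/-- The data of a MIMO full-duplex two-way channel with two nodes, `M` transmit and `N` receive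
antennas per node: front-end noise level `β`, power budgets `P i`, average power gains `η i j`
and matrices `H i j` of the channels from transmitter `i` to receiver `j`. -/
structure Channel (M N : ℕ) where
  β : ℝ
  P : Fin 2 → ℝ
  η : Fin 2 → Fin 2 → ℝ
  H : Fin 2 → Fin 2 → Matrix (Fin N) (Fin M) ℂ

/-- A pair of transmit covariance matrices, one for each node. -/
abbrev Profile (M : ℕ) := Fin 2 → Matrix (Fin M) (Fin M) ℂ

/-- The weighted-maximum Frobenius norm of a pair of matrices. -/
noncomputable def weightedMaxNorm {M : ℕ} (w : Fin 2 → ℝ) (X : Profile M) : ℝ :=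
  max (frobNorm (X 0) / w 0) (frobNorm (X 1) / w 1)

namespace Channel

variable {M N : ℕ} (c : Channel M N)

/-- The gain of the direct channel into node `i` relative to the self-interference channel. -/
noncomputable def γ (i : Fin 2) : ℝ := c.η (other i) i / c.η i i

/-- Covariance matrix of residual self-interference plus thermal noise at receiver `i` when
node `i` transmits with covariance matrix `Q`. -/
noncomputable def noiseCov (i : Fin 2) (Q : Matrix (Fin M) (Fin M) ℂ) :
    Matrix (Fin N) (Fin N) ℂ :=
  1 + ((c.β * c.η i i : ℝ) : ℂ) • (c.H i i * Matrix.diagonal Q.diag * (c.H i i)ᴴ)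

/-- The rate of node `i` (from node `i` to the other node) when node `i` uses the covariance
matrix `S` and the other node uses `T`. The determinant is a real number for feasible `S`, `T`. -/
noncomputable def rate (i : Fin 2) (S T : Matrix (Fin M) (Fin M) ℂ) : ℝ :=
  Real.log (Matrix.det (1 + (c.η i (other i) : ℂ) •
    ((c.H i (other i))ᴴ * (c.noiseCov (other i) T)⁻¹ * c.H i (other i) * S))).re

/-- The feasible transmit covariance matrices of node `i`. -/
def feasible (i : Fin 2) : Set (Matrix (Fin M) (Fin M) ℂ) :=
  {Q | Q.PosSemidef ∧ Q.trace.re ≤ c.P i}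

/-- `S` is a best response of node `i` to the strategy `T` of the other node. -/
def IsBestResponse (i : Fin 2) (T S : Matrix (Fin M) (Fin M) ℂ) : Prop :=
  S ∈ c.feasible i ∧ ∀ S' ∈ c.feasible i, c.rate i S' T ≤ c.rate i S T

/-- Competitive optimality: a feasible strategy profile is a Nash equilibrium if no node can
increase its rate by a unilateral change of strategy. -/
def IsNash (Q : Profile M) : Prop :=
  (∀ i, Q i ∈ c.feasible i) ∧
    ∀ i, ∀ S ∈ c.feasible i, c.rate i S (Q (other i)) ≤ c.rate i (Q i) (Q (other i))

/-- `Φ` is the best-response mapping on feasible profiles: `Φ Q` is the one and only profile each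
of whose components is a best response of that node to the strategy of the other node in `Q`. -/
def IsBestResponseMap (Φ : Profile M → Profile M) : Prop :=
  ∀ Q : Profile M, (∀ i, Q i ∈ c.feasible i) →
    ∀ Q' : Profile M, (∀ i, c.IsBestResponse i (Q (other i)) (Q' i)) ↔ Q' = Φ Q

/-- `Φ` is a contraction on feasible profiles for the weighted-maximum Frobenius norm. -/
def IsContraction (w : Fin 2 → ℝ) (Φ : Profile M → Profile M) : Prop :=
  ∃ κ : ℝ, 0 ≤ κ ∧ κ < 1 ∧ ∀ Q Q' : Profile M,
    (∀ i, Q i ∈ c.feasible i) → (∀ i, Q' i ∈ c.feasible i) →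
      weightedMaxNorm w (Φ Q - Φ Q') ≤ κ * weightedMaxNorm w (Q - Q')

open Classical in
/-- The coefficient of node `i` in the uniqueness condition. -/
noncomputable def α (i : Fin 2) : ℝ :=
  if (c.H (other i) i).rank = N then
    c.β / c.γ i *
      rho ((c.H i i)ᴴ * (pinv (c.H (other i) i))ᴴ * pinv (c.H (other i) i) * c.H i i)
  else
    c.β / c.γ i * (1 + c.β * c.η i i * c.P i * rho ((c.H i i)ᴴ * c.H i i)) *
      rho ((c.H i i)ᴴ * c.H i i) *
      rho ((pinv (c.H (other i) i))ᴴ * pinv (c.H (other i) i))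

end Channel

end FullDuplex

/-!
# Uniqueness of the Nash equilibrium by water-filling as a projection

For a fixed strategy of the other node, node `i` maximizes `log det (I + G S)` over the positive
semidefinite `S` of trace at most `P`, where `G = η Hᴴ Σ⁻¹ H ≠ 0`. With `D = (I + G S)⁻¹ G` the
gradient at a maximizer, the first-order condition yields a number `μ > 0` with `D ≤ μ`,
`D S = μ S` and `tr S = P` (`IsRateMax.exists_waterLevel`). On the range of `G` the inverse of `D`
is `S + X`, with `X` the generalized inverse of `G`. Hence `S + X ≥ μ⁻¹` there, with equality on the
range of `S`, which yields the variational inequality saying that `S` is the point nearest to `-X`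
among the matrices of trace `P` that live on the range of `G`
(`IsRateMax.trace_add_pinv_mul_nonneg`). That range is the range of `Hᴴ`, whatever the strategy of
the other node is, so two maximizers satisfy `‖S₁ - S₂‖ ≤ ‖X₁ - X₂‖` in the Frobenius norm
(`IsRateMax.frobNorm_sub_le`). Uniqueness of the best response is the case `X₁ = X₂`; existence is
compactness.

It remains to see how `X` depends on the noise covariance. Let `L = η X Hᴴ Σ⁻¹` be the weighted
generalized inverse of `H`. The identity `X₁ - X₂ = η⁻¹ L₁ (Σ₁ - Σ₂) L₂ᴴ`
(`pinv_gain_sub_pinv_gain`) reduces everything to a bound on `L`. If `H` has full row rank, `L` is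
the Moore-Penrose inverse `H⁻¹` (`weightedPinv_eq_pinv`). In general `Σ ≥ I` and the Gauss-Markov
inequality `L Σ Lᴴ ≤ H⁻¹ Σ H⁻ᴴ` give `‖L‖² ≤ ‖Σ‖ ‖H⁻¹‖²` (`norm_weightedPinv_sq_le`). Either way
the best response is Lipschitz with constant `α j` in the strategy of the other node `j`
(`Channel.frobNorm_bestResponse_sub_le`). As `α 0 * α 1 < 1`, the composition of the two best
responses is a contraction of a compact set, whose fixed point is the Nash equilibrium, and suitable
weights balance the two constants (`exists_weights`).
-/

namespace FullDuplex

/-! ### Trace, Frobenius norm and operator norm of complex matrices -/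

section MatrixPreliminaries

variable {m n l : Type*} [Fintype m] [Fintype n] [Fintype l]

open scoped MatrixOrder in
theorem exists_eq_conjTranspose_mul_self {A : Matrix n n ℂ} (hA : A.PosSemidef) :
    ∃ B : Matrix n n ℂ, A = Bᴴ * B := by
  classical
  exact CStarAlgebra.nonneg_iff_eq_star_mul_self.mp hA.nonneg

theorem trace_mul_nonneg {A B : Matrix n n ℂ} (hA : A.PosSemidef) (hB : B.PosSemidef) :
    0 ≤ (A * B).trace.re := by
  obtain ⟨C, rfl⟩ := exists_eq_conjTranspose_mul_self hA
  rw [Matrix.mul_assoc, Matrix.trace_mul_comm]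
  exact (Complex.le_def.mp (hB.mul_mul_conjTranspose_same C).trace_nonneg).1

/-- Complementary slackness: two positive semidefinite matrices that are orthogonal for the trace
pairing have product zero. -/
theorem mul_eq_zero_of_trace_mul {A B : Matrix n n ℂ} (hA : A.PosSemidef) (hB : B.PosSemidef)
    (h : (A * B).trace.re ≤ 0) : A * B = 0 := by
  obtain ⟨C, rfl⟩ := exists_eq_conjTranspose_mul_self hA
  obtain ⟨E, rfl⟩ := exists_eq_conjTranspose_mul_self hB
  have e : (Cᴴ * C * (Eᴴ * E)).trace = ((C * Eᴴ) * (C * Eᴴ)ᴴ).trace := by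
    rw [Matrix.conjTranspose_mul, Matrix.conjTranspose_conjTranspose, Matrix.mul_assoc,
      Matrix.trace_mul_comm]
    simp only [Matrix.mul_assoc]
  have h0 := (Matrix.posSemidef_self_mul_conjTranspose (C * Eᴴ)).trace_nonneg
  rw [e] at h
  have h1 : ((C * Eᴴ) * (C * Eᴴ)ᴴ).trace = 0 :=
    le_antisymm (Complex.le_def.mpr ⟨h, (Complex.le_def.mp h0).2.symm⟩) h0
  have h2 := Matrix.trace_mul_conjTranspose_self_eq_zero_iff.mp h1
  calc Cᴴ * C * (Eᴴ * E) = Cᴴ * (C * Eᴴ) * E := by simp only [Matrix.mul_assoc]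
    _ = 0 := by rw [h2]; simp

/-- A Hermitian matrix whose trace pairing with every `v vᴴ` is nonnegative is positive
semidefinite. -/
theorem posSemidef_of_trace_mul {A : Matrix n n ℂ} (hA : A.IsHermitian)
    (h : ∀ v : n → ℂ, 0 ≤ (A * Matrix.vecMulVec v (star v)).trace.re) : A.PosSemidef := by
  refine .of_dotProduct_mulVec_nonneg hA fun v => ?_
  have e : (A * Matrix.vecMulVec v (star v)).trace = star v ⬝ᵥ A *ᵥ v := by
    rw [Matrix.mul_vecMulVec, Matrix.trace_vecMulVec, dotProduct_comm]
  have h1 := h v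
  rw [e] at h1
  have h2 : (star v ⬝ᵥ A *ᵥ v).im = 0 := by
    have := hA.im_star_dotProduct_mulVec_self v
    simpa using this
  exact Complex.le_def.mpr ⟨h1, h2.symm⟩

theorem IsMoorePenrose.conjTranspose {A : Matrix m n ℂ}
    {X : Matrix n m ℂ} (h : IsMoorePenrose A X) : IsMoorePenrose Aᴴ Xᴴ where
  mul_mul_self := by
    rw [← Matrix.conjTranspose_mul, ← Matrix.conjTranspose_mul, ← Matrix.mul_assoc, h.1]
  self_mul_mul := by
    rw [← Matrix.conjTranspose_mul, ← Matrix.conjTranspose_mul, ← Matrix.mul_assoc, h.2]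
  isHermitian_left := by
    rw [← Matrix.conjTranspose_mul]; exact h.4.conjTranspose
  isHermitian_right := by
    rw [← Matrix.conjTranspose_mul]; exact h.3.conjTranspose

theorem IsMoorePenrose.isHermitian {G X : Matrix n n ℂ} (h : IsMoorePenrose G X)
    (hG : G.IsHermitian) : X.IsHermitian := by
  have h1 := h.conjTranspose
  rw [hG.eq] at h1
  exact h1.unique h

theorem IsMoorePenrose.mul_comm {G X : Matrix n n ℂ} (h : IsMoorePenrose G X)
    (hG : G.IsHermitian) : G * X = X * G := by
  rw [← h.isHermitian_left.eq, Matrix.conjTranspose_mul, hG.eq, (h.isHermitian hG).eq]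

theorem frobNorm_sq (A : Matrix m n ℂ) : frobNorm A ^ 2 = (Aᴴ * A).trace.re := by
  let _ : NormedAddCommGroup (Matrix m n ℂ) := Matrix.frobeniusNormedAddCommGroup
  have h : frobNorm A = (∑ i, ∑ j, ‖A i j‖ ^ (2 : ℝ)) ^ (1 / 2 : ℝ) :=
    Matrix.frobenius_norm_def A
  rw [h, ← Real.sqrt_eq_rpow, Real.sq_sqrt (by positivity), Finset.sum_comm]
  simp only [Matrix.trace, Matrix.diag, Matrix.mul_apply, Matrix.conjTranspose_apply,
    Complex.re_sum]
  refine Finset.sum_congr rfl fun j _ => Finset.sum_congr rfl fun i _ => ?_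
  have : star (A i j) * A i j = ((‖A i j‖ ^ 2 : ℝ) : ℂ) := by
    rw [Complex.star_def, Complex.conj_mul']; push_cast; rfl
  rw [this, Complex.ofReal_re, Real.rpow_two]

theorem frobNorm_nonneg (A : Matrix m n ℂ) : 0 ≤ frobNorm A := by
  let _ : NormedAddCommGroup (Matrix m n ℂ) := Matrix.frobeniusNormedAddCommGroup
  exact norm_nonneg A

theorem frobNorm_conjTranspose (A : Matrix m n ℂ) : frobNorm Aᴴ = frobNorm A :=
  Matrix.frobenius_norm_conjTranspose A

theorem eq_of_frobNorm_sub {A B : Matrix m n ℂ} (h : frobNorm (A - B) = 0) : A = B := by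
  let _ : NormedAddCommGroup (Matrix m n ℂ) := Matrix.frobeniusNormedAddCommGroup
  exact sub_eq_zero.mp (norm_eq_zero.mp h)

theorem frobNorm_zero : frobNorm (0 : Matrix m n ℂ) = 0 := by
  let _ : NormedAddCommGroup (Matrix m n ℂ) := Matrix.frobeniusNormedAddCommGroup
  exact norm_zero

theorem frobNorm_smul (r : ℂ) (A : Matrix m n ℂ) : frobNorm (r • A) = ‖r‖ * frobNorm A := by
  let _ : NormedAddCommGroup (Matrix m n ℂ) := Matrix.frobeniusNormedAddCommGroup
  let _ : NormedSpace ℂ (Matrix m n ℂ) := Matrix.frobeniusNormedSpace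
  exact norm_smul r A

theorem frobNorm_diagonal_diag_le [DecidableEq n] (A : Matrix n n ℂ) :
    frobNorm (Matrix.diagonal A.diag) ≤ frobNorm A := by
  have h : ∀ B : Matrix n n ℂ, frobNorm B = (∑ i, ∑ j, ‖B i j‖ ^ (2 : ℝ)) ^ (1 / 2 : ℝ) :=
    fun B => Matrix.frobenius_norm_def B
  rw [h, h]
  gcongr with i _ j _
  rcases eq_or_ne i j with rfl | hij
  · simp
  · simp [Matrix.diagonal_apply_ne _ hij]

section OperatorNorm

-- In this section `‖A‖` is the operator norm for the Euclidean norms.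
open scoped Matrix.Norms.L2Operator MatrixOrder

theorem rho_eq_norm [DecidableEq n] {A : Matrix n n ℂ} (hA : A.IsHermitian) : rho A = ‖A‖ := by
  unfold rho
  rw [IsSelfAdjoint.spectralRadius_eq_nnnorm (A := Matrix n n ℂ) hA]
  rfl

theorem rho_conjTranspose_mul_self [DecidableEq n] (A : Matrix m n ℂ) :
    rho (Aᴴ * A) = ‖A‖ ^ 2 := by
  rw [rho_eq_norm (Matrix.isHermitian_conjTranspose_mul_self A),
    Matrix.l2_opNorm_conjTranspose_mul_self, sq]

theorem frobNorm_mul_le [DecidableEq m] [DecidableEq n] (A : Matrix l m ℂ) (B : Matrix m n ℂ) :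
    frobNorm (A * B) ≤ ‖A‖ * frobNorm B := by
  refine le_of_sq_le_sq ?_ (mul_nonneg (norm_nonneg A) (frobNorm_nonneg B))
  have h1 : Aᴴ * A ≤ algebraMap ℝ (Matrix m m ℂ) ‖Aᴴ * A‖ :=
    IsSelfAdjoint.le_algebraMap_norm_self
      (Matrix.isHermitian_conjTranspose_mul_self A : IsSelfAdjoint (Aᴴ * A))
  have h2 := (Matrix.le_iff.mp h1).conjTranspose_mul_mul_same B
  have h3 := (Complex.le_def.mp h2.trace_nonneg).1
  rw [mul_pow, frobNorm_sq, frobNorm_sq, sq ‖A‖, ← Matrix.l2_opNorm_conjTranspose_mul_self]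
  have e : Bᴴ * (algebraMap ℝ (Matrix m m ℂ) ‖Aᴴ * A‖ - Aᴴ * A) * B
      = ((‖Aᴴ * A‖ : ℝ) : ℂ) • (Bᴴ * B) - (A * B)ᴴ * (A * B) := by
    rw [Algebra.algebraMap_eq_smul_one, Matrix.mul_sub, Matrix.sub_mul, Matrix.conjTranspose_mul]
    simp [Matrix.mul_assoc]
  rw [e, Matrix.trace_sub, Matrix.trace_smul] at h3
  simpa using h3

theorem frobNorm_mul_mul_conjTranspose_le [DecidableEq m] [DecidableEq n] [DecidableEq l]
    (A : Matrix l m ℂ) (B : Matrix m m ℂ) (C : Matrix n m ℂ) :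
    frobNorm (A * B * Cᴴ) ≤ ‖A‖ * ‖C‖ * frobNorm B := by
  calc frobNorm (A * B * Cᴴ) = frobNorm (A * (B * Cᴴ)) := by rw [Matrix.mul_assoc]
    _ ≤ ‖A‖ * frobNorm (B * Cᴴ) := frobNorm_mul_le _ _
    _ = ‖A‖ * frobNorm (C * Bᴴ) := by
      rw [← frobNorm_conjTranspose (B * Cᴴ), Matrix.conjTranspose_mul,
        Matrix.conjTranspose_conjTranspose]
    _ ≤ ‖A‖ * (‖C‖ * frobNorm Bᴴ) := by gcongr; exact frobNorm_mul_le _ _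
    _ = _ := by rw [frobNorm_conjTranspose, mul_assoc]

theorem norm_le_of_posSemidef_sub [DecidableEq n] {A B : Matrix n n ℂ} (hA : A.PosSemidef)
    (hAB : (B - A).PosSemidef) : ‖A‖ ≤ ‖B‖ :=
  CStarAlgebra.norm_le_norm_of_nonneg_of_le hA.nonneg hAB

theorem norm_diagonal_diag_le_trace [DecidableEq n] {A : Matrix n n ℂ} (hA : A.PosSemidef) :
    ‖Matrix.diagonal A.diag‖ ≤ A.trace.re := by
  have h0 : ∀ i, 0 ≤ A i i := fun i => hA.diag_nonneg
  rw [Matrix.l2_opNorm_diagonal,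
    pi_norm_le_iff_of_nonneg (Complex.le_def.mp hA.trace_nonneg).1]
  intro i
  have h1 : ‖A.diag i‖ = (A i i).re := Complex.norm_of_nonneg' (h0 i) ▸ rfl
  rw [h1, Matrix.trace, Complex.re_sum]
  exact Finset.single_le_sum (f := fun j => (A j j).re)
    (fun j _ => (Complex.le_def.mp (h0 j)).1) (Finset.mem_univ i)

end OperatorNorm

end MatrixPreliminaries

/-! ### Water-filling -/

section WaterFilling

variable {n : Type*} [Fintype n]

/-- The positive semidefinite matrices of trace at most `P`: the covariance matrices that respect
the power budget `P`. `FullDuplex.Channel.feasible` unfolds to it. -/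
def powerSet (P : ℝ) : Set (Matrix n n ℂ) := {Q | Q.PosSemidef ∧ Q.trace.re ≤ P}

theorem eq_zero_of_mem_powerSet_zero {S : Matrix n n ℂ} (h : S ∈ powerSet 0) : S = 0 := by
  refine h.1.trace_eq_zero_iff.mp (le_antisymm ?_ h.1.trace_nonneg)
  exact Complex.le_def.mpr ⟨h.2, (Complex.le_def.mp h.1.trace_nonneg).2.symm⟩

variable [DecidableEq n]

/-- `S` maximizes the rate `log det (I + G S)` over the covariance matrices of power at most `P`.
The effective gain matrix `G` of the channel is meant to be positive semidefinite. -/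
def IsRateMax (G : Matrix n n ℂ) (P : ℝ) (S : Matrix n n ℂ) : Prop :=
  S ∈ powerSet P ∧ ∀ S' ∈ powerSet P,
    Real.log (Matrix.det (1 + G * S')).re ≤ Real.log (Matrix.det (1 + G * S)).re

/-- The gradient of `S ↦ log det (I + G S)` for the trace pairing. The matrix inverse is a genuine
one for positive semidefinite `G` and `S` (`isUnit_det_one_add_mul`). -/
noncomputable def rateGrad (G S : Matrix n n ℂ) : Matrix n n ℂ := (1 + G * S)⁻¹ * G

theorem posDef_one_add {m : Type*} [DecidableEq m] {A : Matrix m m ℂ} (hA : A.PosSemidef) :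
    (1 + A).PosDef :=
  Matrix.PosDef.one.add_posSemidef hA

theorem det_one_add_mul_pos {G S : Matrix n n ℂ} (hG : G.PosSemidef) (hS : S.PosSemidef) :
    0 < Matrix.det (1 + G * S) := by
  obtain ⟨B, rfl⟩ := exists_eq_conjTranspose_mul_self hG
  rw [Matrix.mul_assoc, Matrix.det_one_add_mul_comm]
  exact (posDef_one_add (hS.mul_mul_conjTranspose_same B)).det_pos

theorem isUnit_det_one_add_mul {G S : Matrix n n ℂ} (hG : G.PosSemidef) (hS : S.PosSemidef) :
    IsUnit (Matrix.det (1 + G * S)) :=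
  isUnit_iff_ne_zero.mpr (det_one_add_mul_pos hG hS).ne'

theorem one_add_mul_rateGrad {G S : Matrix n n ℂ} (hG : G.PosSemidef) (hS : S.PosSemidef) :
    (1 + G * S) * rateGrad G S = G :=
  Matrix.mul_nonsing_inv_cancel_left _ _ (isUnit_det_one_add_mul hG hS)

theorem rateGrad_posSemidef {G S : Matrix n n ℂ} (hG : G.PosSemidef) (hS : S.PosSemidef) :
    (rateGrad G S).PosSemidef := by
  obtain ⟨B, rfl⟩ := exists_eq_conjTranspose_mul_self hG
  have hW := posDef_one_add (hS.mul_mul_conjTranspose_same B)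
  have hWu : IsUnit (1 + B * S * Bᴴ).det := isUnit_iff_ne_zero.mpr hW.det_pos.ne'
  have e : rateGrad (Bᴴ * B) S = Bᴴ * (1 + B * S * Bᴴ)⁻¹ * B := by
    have h1 : (1 + Bᴴ * B * S) * (Bᴴ * (1 + B * S * Bᴴ)⁻¹ * B) = Bᴴ * B := by
      calc (1 + Bᴴ * B * S) * (Bᴴ * (1 + B * S * Bᴴ)⁻¹ * B)
          = Bᴴ * ((1 + B * S * Bᴴ) * (1 + B * S * Bᴴ)⁻¹) * B := by
            simp only [Matrix.add_mul, Matrix.mul_add, Matrix.one_mul, Matrix.mul_assoc]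
        _ = Bᴴ * B := by rw [Matrix.mul_nonsing_inv _ hWu, Matrix.mul_one]
    calc rateGrad (Bᴴ * B) S
        = (1 + Bᴴ * B * S)⁻¹ * ((1 + Bᴴ * B * S) * (Bᴴ * (1 + B * S * Bᴴ)⁻¹ * B)) := by
          rw [h1]; rfl
      _ = _ := Matrix.nonsing_inv_mul_cancel_left _ _
        (isUnit_det_one_add_mul (Matrix.posSemidef_conjTranspose_mul_self B) hS)
  rw [e]
  exact hW.inv.posSemidef.conjTranspose_mul_mul_same B

theorem rateGrad_mul_one_add {G S : Matrix n n ℂ} (hG : G.PosSemidef) (hS : S.PosSemidef) :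
    rateGrad G S * (1 + S * G) = G := by
  have h := congrArg Matrix.conjTranspose (one_add_mul_rateGrad hG hS)
  simpa only [Matrix.conjTranspose_mul, Matrix.conjTranspose_add, Matrix.conjTranspose_one,
    hG.isHermitian.eq, hS.isHermitian.eq, (rateGrad_posSemidef hG hS).isHermitian.eq] using h

/-- The first-order optimality condition for a maximizer of the rate. -/
theorem IsRateMax.trace_rateGrad_mul_le {G S S' : Matrix n n ℂ} {P : ℝ} (hG : G.PosSemidef)
    (h : IsRateMax G P S) (hS' : S' ∈ powerSet P) :
    (rateGrad G S * (S' - S)).trace.re ≤ 0 := by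
  obtain ⟨hS, hmax⟩ := h
  set A := 1 + G * S with hA
  set E := S' - S with hE
  -- `det (1 + t D E) = 1 + t tr (D E) + t² q(t)` for the gradient `D`, so the sign of the linear
  -- term is read off for small `t > 0`.
  set q : Polynomial ℂ := (Matrix.det (1 + (Polynomial.X : Polynomial ℂ) •
    (rateGrad G S * E).map Polynomial.C)).divX.divX with hq
  have hpos := det_one_add_mul_pos hG hS.1
  rw [← hA, Complex.lt_def] at hpos
  simp only [Complex.zero_re, Complex.zero_im] at hpos
  have key : ∀ t : ℝ, 0 < t → t ≤ 1 →
      (rateGrad G S * E).trace.re + t * (q.eval (t : ℂ)).re ≤ 0 := by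
    intro t ht ht1
    have hmem : S + (t : ℂ) • E ∈ powerSet P := by
      have e : S + (t : ℂ) • E = (1 - t) • S + t • S' := by
        ext i j
        simp only [hE, Matrix.add_apply, Matrix.smul_apply, Matrix.sub_apply, smul_eq_mul,
          Complex.real_smul]
        push_cast; ring
      rw [e]
      refine ⟨(hS.1.smul (by linarith)).add (hS'.1.smul ht.le), ?_⟩
      simp only [Matrix.trace_add, Matrix.trace_smul, Complex.add_re, Complex.smul_re, smul_eq_mul]
      nlinarith [hS.2, hS'.2]
    have hdet : Matrix.det (1 + G * (S + (t : ℂ) • E)) = A.det *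
        (1 + (rateGrad G S * E).trace * t + q.eval (t : ℂ) * (t : ℂ) ^ 2) := by
      rw [hq, ← Matrix.det_one_add_smul, ← Matrix.det_mul]
      congr 1
      have : A * rateGrad G S = G := one_add_mul_rateGrad hG hS.1
      rw [Matrix.mul_add, Matrix.mul_add, Matrix.mul_smul, Matrix.mul_smul, ← Matrix.mul_assoc,
        this, Matrix.mul_one, hA, add_assoc]
    have h1 := hmax _ hmem
    have hp := (Complex.lt_def.mp (det_one_add_mul_pos hG hmem.1)).1
    rw [Real.log_le_log_iff hp hpos.1, hdet, Complex.mul_re, ← hpos.2, zero_mul, sub_zero] at h1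
    have h2 := le_of_mul_le_mul_left (h1.trans_eq (mul_one _).symm) hpos.1
    have h3 : t * ((rateGrad G S * E).trace.re + t * (q.eval (t : ℂ)).re) ≤ 0 := by
      have e : (1 + (rateGrad G S * E).trace * t + q.eval (t : ℂ) * (t : ℂ) ^ 2).re
          = 1 + t * ((rateGrad G S * E).trace.re + t * (q.eval (t : ℂ)).re) := by
        rw [← Complex.ofReal_pow]
        simp only [Complex.add_re, Complex.one_re, Complex.re_mul_ofReal]
        ring
      linarith
    exact nonpos_of_mul_nonpos_right h3 ht
  have hcont : Continuous fun t : ℝ =>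
      (rateGrad G S * E).trace.re + t * (q.eval (t : ℂ)).re := by fun_prop
  have hlim := (hcont.tendsto 0).mono_left (nhdsWithin_le_nhds (s := Set.Ioi 0))
  simp only [zero_mul, add_zero] at hlim
  refine le_of_tendsto hlim ?_
  filter_upwards [Ioc_mem_nhdsGT (zero_lt_one' ℝ)] with t ht using key t ht.1 ht.2

/-- The Karush-Kuhn-Tucker conditions of water-filling: at a maximizer of the rate the gradient is
at most `μ` (the inverse of the water level), equals `μ` on the range of the maximizer, and the
whole power budget is spent. -/
theorem IsRateMax.exists_waterLevel {G S : Matrix n n ℂ} {P : ℝ} (hG : G.PosSemidef) (hG0 : G ≠ 0)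
    (hP : 0 < P) (h : IsRateMax G P S) :
    ∃ μ : ℝ, 0 < μ ∧ ((μ : ℂ) • (1 : Matrix n n ℂ) - rateGrad G S).PosSemidef ∧
      rateGrad G S * S = (μ : ℂ) • S ∧ S.trace.re = P := by
  have hS := h.1
  set D := rateGrad G S with hD
  have hDp : D.PosSemidef := rateGrad_posSemidef hG hS.1
  have hvi : ∀ S' ∈ powerSet P, (D * S').trace.re ≤ (D * S).trace.re := by
    intro S' hS'
    have h1 := h.trace_rateGrad_mul_le hG hS'
    rw [Matrix.mul_sub, Matrix.trace_sub, Complex.sub_re] at h1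
    linarith
  set μ : ℝ := (D * S).trace.re / P with hμ
  have hμP : μ * P = (D * S).trace.re := div_mul_cancel₀ _ hP.ne'
  have hle : ((μ : ℂ) • (1 : Matrix n n ℂ) - D).PosSemidef := by
    refine posSemidef_of_trace_mul ?_ fun v => ?_
    · exact (Matrix.IsHermitian.smul Matrix.isHermitian_one (Complex.conj_ofReal μ)).sub
        hDp.isHermitian
    have hV := Matrix.posSemidef_vecMulVec_self_star v
    set V := Matrix.vecMulVec v (star v)
    have ht := (Complex.le_def.mp hV.trace_nonneg).1
    rw [Matrix.sub_mul, Matrix.trace_sub, Matrix.smul_mul, Matrix.one_mul, Matrix.trace_smul,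
      Complex.sub_re, smul_eq_mul, Complex.re_ofReal_mul, sub_nonneg]
    rcases ht.eq_or_lt with h0 | h0
    · have : V = 0 := by
        refine hV.trace_eq_zero_iff.mp (Complex.ext h0.symm ?_)
        exact (Complex.le_def.mp hV.trace_nonneg).2.symm
      rw [this]; simp
    · -- `V`, rescaled to the full power, competes with `S`.
      simp only [Complex.zero_re] at h0
      have h1 := hvi ((P / V.trace.re) • V) ⟨hV.smul (by positivity), by
        rw [Matrix.trace_smul, Complex.smul_re, smul_eq_mul, div_mul_cancel₀ _ h0.ne']⟩
      rw [Matrix.mul_smul, Matrix.trace_smul, Complex.smul_re, smul_eq_mul, ← hμP,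
        div_mul_eq_mul_div, div_le_iff₀ h0] at h1
      have : P * (D * V).trace.re ≤ P * (μ * V.trace.re) := by linarith
      exact le_of_mul_le_mul_left this hP
  have hD0 : D ≠ 0 := by
    intro h0
    have := one_add_mul_rateGrad hG hS.1
    rw [← hD, h0, Matrix.mul_zero] at this
    exact hG0 this.symm
  have hμ0 : 0 < μ := by
    refine lt_of_le_of_ne (div_nonneg (trace_mul_nonneg hDp hS.1) hP.le) fun h0 => hD0 ?_
    rw [← h0] at hle
    simp only [Complex.ofReal_zero, zero_smul, zero_sub] at hle
    refine hDp.trace_eq_zero_iff.mp (le_antisymm ?_ hDp.trace_nonneg)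
    simpa using hle.trace_nonneg
  have htr : (((μ : ℂ) • (1 : Matrix n n ℂ) - D) * S).trace.re = μ * (S.trace.re - P) := by
    rw [Matrix.sub_mul, Matrix.trace_sub, Matrix.smul_mul, Matrix.one_mul, Matrix.trace_smul,
      Complex.sub_re, smul_eq_mul, Complex.re_ofReal_mul, ← hμP]
    ring
  have hSP : S.trace.re - P ≤ 0 := by linarith [hS.2]
  refine ⟨μ, hμ0, hle, ?_, ?_⟩
  · have h0 := mul_eq_zero_of_trace_mul hle hS.1
      (htr.trans_le (mul_nonpos_of_nonneg_of_nonpos hμ0.le hSP))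
    rw [Matrix.sub_mul, Matrix.smul_mul, Matrix.one_mul, sub_eq_zero] at h0
    exact h0.symm
  · have h0 := trace_mul_nonneg hle hS.1
    rw [htr] at h0
    have := nonneg_of_mul_nonneg_right h0 hμ0
    linarith

/-- A maximizer of the rate lives on the range of `G`, onto which `X * G` projects. -/
theorem IsRateMax.proj_mul {G X S : Matrix n n ℂ} {P : ℝ} (hG : G.PosSemidef) (hG0 : G ≠ 0)
    (hP : 0 < P) (hX : IsMoorePenrose G X) (h : IsRateMax G P S) : X * G * S = S := by
  obtain ⟨μ, hμ, -, hDS, -⟩ := h.exists_waterLevel hG hG0 hP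
  have hpG : X * G * G = G := by rw [← hX.mul_comm hG.1, hX.mul_mul_self]
  have hD : rateGrad G S = G * (1 - S * rateGrad G S) := by
    have := one_add_mul_rateGrad hG h.1.1
    rw [Matrix.add_mul, Matrix.one_mul] at this
    rw [Matrix.mul_sub, Matrix.mul_one, ← Matrix.mul_assoc]
    exact eq_sub_of_add_eq this
  have hpD : X * G * rateGrad G S = rateGrad G S := by
    calc X * G * rateGrad G S = X * G * (G * (1 - S * rateGrad G S)) := by rw [← hD]
      _ = rateGrad G S := by rw [← Matrix.mul_assoc, hpG, ← hD]
  have h1 : (μ : ℂ) • (X * G * S) = (μ : ℂ) • S := by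
    rw [← Matrix.mul_smul, ← hDS, ← Matrix.mul_assoc, hpD]
  exact smul_right_injective _ (Complex.ofReal_ne_zero.mpr hμ.ne') h1

open scoped MatrixOrder Matrix.Norms.L2Operator in
/-- Water-filling as a projection: among the positive semidefinite matrices `S'` of full power on
the range of `G`, the maximizer `S` is the one nearest to `-X`, as this variational inequality says.
It holds since `S + X` is, on the range of `G`, the inverse of the gradient, so that it is bounded
below by `μ⁻¹` with equality on the range of `S`. -/
theorem IsRateMax.trace_add_pinv_mul_nonneg {G X S S' : Matrix n n ℂ} {P : ℝ} (hG : G.PosSemidef)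
    (hG0 : G ≠ 0) (hP : 0 < P) (hX : IsMoorePenrose G X) (h : IsRateMax G P S)
    (hS' : S'.PosSemidef) (htr : S'.trace.re = P) (hpS' : X * G * S' = S') :
    0 ≤ ((S + X) * (S' - S)).trace.re := by
  have hpS := h.proj_mul hG hG0 hP hX
  obtain ⟨μ, hμ, hle, hDS, hSP⟩ := h.exists_waterLevel hG hG0 hP
  have hDh := rateGrad_posSemidef hG h.1.1
  have hDG := rateGrad_mul_one_add hG h.1.1
  set D := rateGrad G S
  set Y := S + X with hY
  have hXh := hX.isHermitian hG.1
  have hYh : Yᴴ = Y := by rw [hY, Matrix.conjTranspose_add, h.1.1.1.eq, hXh.eq]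
  have hSp : S * (X * G) = S := by
    have := congrArg Matrix.conjTranspose hpS
    rwa [Matrix.conjTranspose_mul, hX.isHermitian_right.eq, h.1.1.1.eq] at this
  have hDY : D * Y = X * G := by
    have h1 : D * (1 + S * G) * X = G * X := by rw [hDG]
    rw [Matrix.mul_assoc, Matrix.add_mul, Matrix.one_mul, Matrix.mul_assoc S,
      hX.mul_comm hG.1, hSp, add_comm] at h1
    exact h1
  have hYD : Y * D = X * G := by
    have := congrArg Matrix.conjTranspose hDY
    rwa [Matrix.conjTranspose_mul, hYh, hDh.1.eq, hX.isHermitian_right.eq] at this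
  have hpY : X * G * Y = Y := by rw [hY, Matrix.mul_add, hpS, hX.self_mul_mul]
  have hYS : (μ : ℂ) • (Y * S) = S := by
    rw [← Matrix.mul_smul, ← hDS, ← Matrix.mul_assoc, hYD, hpS]
  -- `μ Y - p = Y D (μ - D) Y` for the projection `p = X G` onto the range of `G`.
  have hpsd : ((μ : ℂ) • Y - X * G).PosSemidef := by
    have hc : Commute D ((μ : ℂ) • (1 : Matrix n n ℂ) - D) := by
      simp [commute_iff_eq, Matrix.mul_sub, Matrix.sub_mul]
    have h1 := (Matrix.nonneg_iff_posSemidef.mp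
      (Commute.mul_nonneg hDh.nonneg hle.nonneg hc)).conjTranspose_mul_mul_same Y
    have e : Yᴴ * (D * ((μ : ℂ) • (1 : Matrix n n ℂ) - D)) * Y = (μ : ℂ) • Y - X * G := by
      calc Yᴴ * (D * ((μ : ℂ) • (1 : Matrix n n ℂ) - D)) * Y
          = (μ : ℂ) • (Y * D * Y) - (Y * D) * (D * Y) := by
            rw [hYh]; simp [Matrix.mul_sub, Matrix.sub_mul, Matrix.mul_assoc]
        _ = (μ : ℂ) • Y - X * G := by
            rw [hYD, hpY, hDY, ← Matrix.mul_assoc, hX.self_mul_mul]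
    rwa [e] at h1
  have h2 := trace_mul_nonneg hpsd hS'
  rw [Matrix.sub_mul, hpS', Matrix.trace_sub, Complex.sub_re, htr, Matrix.smul_mul,
    Matrix.trace_smul, smul_eq_mul, Complex.re_ofReal_mul] at h2
  have h3 : μ * (Y * S).trace.re = P := by
    rw [← hSP]
    conv_rhs => rw [← hYS]
    rw [Matrix.trace_smul, smul_eq_mul, Complex.re_ofReal_mul]
  rw [Matrix.mul_sub, Matrix.trace_sub, Complex.sub_re]
  refine nonneg_of_mul_nonneg_right (a := μ) ?_ hμ
  linarith

/-- Projections are nonexpansive: maximizers of the rate for two gain matrices with the same range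
are at most as far apart as the generalized inverses of the gain matrices. -/
theorem IsRateMax.frobNorm_sub_le {G₁ G₂ X₁ X₂ S₁ S₂ : Matrix n n ℂ} {P : ℝ} (hP : 0 ≤ P)
    (hG₁ : G₁.PosSemidef) (hG₂ : G₂.PosSemidef) (h₁0 : G₁ ≠ 0) (h₂0 : G₂ ≠ 0)
    (hX₁ : IsMoorePenrose G₁ X₁) (hX₂ : IsMoorePenrose G₂ X₂) (hXG : X₁ * G₁ = X₂ * G₂)
    (h₁ : IsRateMax G₁ P S₁) (h₂ : IsRateMax G₂ P S₂) :
    frobNorm (S₁ - S₂) ≤ frobNorm (X₁ - X₂) := by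
  rcases hP.eq_or_lt with rfl | hP
  · rw [eq_zero_of_mem_powerSet_zero h₁.1, eq_zero_of_mem_powerSet_zero h₂.1, sub_zero,
      frobNorm_zero]
    exact frobNorm_nonneg _
  have hp₁ := h₁.proj_mul hG₁ h₁0 hP hX₁
  have hp₂ := h₂.proj_mul hG₂ h₂0 hP hX₂
  obtain ⟨-, -, -, -, ht₁⟩ := h₁.exists_waterLevel hG₁ h₁0 hP
  obtain ⟨-, -, -, -, ht₂⟩ := h₂.exists_waterLevel hG₂ h₂0 hP
  have i₁ := h₁.trace_add_pinv_mul_nonneg hG₁ h₁0 hP hX₁ h₂.1.1 ht₂ (hXG ▸ hp₂)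
  have i₂ := h₂.trace_add_pinv_mul_nonneg hG₂ h₂0 hP hX₂ h₁.1.1 ht₁ (hXG ▸ hp₁)
  set E := S₁ - S₂ with hE
  set F := X₁ - X₂ with hF
  have hEh : Eᴴ = E := by rw [hE, Matrix.conjTranspose_sub, h₁.1.1.1.eq, h₂.1.1.1.eq]
  have hFh : Fᴴ = F := by
    rw [hF, Matrix.conjTranspose_sub, (hX₁.isHermitian hG₁.1).eq, (hX₂.isHermitian hG₂.1).eq]
  have hsum : (E * E).trace.re + (F * E).trace.re ≤ 0 := by
    have e : (S₁ + X₁) * (S₂ - S₁) + (S₂ + X₂) * (S₁ - S₂) = -(E * E + F * E) := by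
      rw [hE, hF]; noncomm_ring
    have := congrArg (fun A => (Matrix.trace A).re) e
    simp only [Matrix.trace_add, Matrix.trace_neg, Complex.add_re, Complex.neg_re] at this
    linarith
  refine le_of_sq_le_sq ?_ (frobNorm_nonneg _)
  -- Expand `0 ≤ ‖E + F‖²`.
  have h0 := sq_nonneg (frobNorm (E + F))
  rw [frobNorm_sq, Matrix.conjTranspose_add, hEh, hFh, Matrix.add_mul, Matrix.mul_add,
    Matrix.mul_add, Matrix.trace_add, Matrix.trace_add, Matrix.trace_add,
    Matrix.trace_mul_comm E F] at h0
  simp only [Complex.add_re] at h0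
  rw [frobNorm_sq, frobNorm_sq, hEh, hFh]
  linarith

end WaterFilling

/-! ### Compactness: maximizers and fixed points -/

section Existence

variable {n : Type*} [Fintype n]

theorem zero_mem_powerSet {P : ℝ} (hP : 0 ≤ P) : (0 : Matrix n n ℂ) ∈ powerSet P :=
  ⟨Matrix.PosSemidef.zero, by simpa using hP⟩

section Frobenius

open scoped Matrix.Norms.Frobenius

theorem frobNorm_le_of_mem_powerSet {P : ℝ} {Q : Matrix n n ℂ} (h : Q ∈ powerSet P) :
    frobNorm Q ≤ P := by
  refine le_trans ?_ h.2
  obtain ⟨B, rfl⟩ := exists_eq_conjTranspose_mul_self h.1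
  rw [← frobNorm_sq, sq]
  nth_rewrite 2 [← frobNorm_conjTranspose]
  exact Matrix.frobenius_norm_mul _ _

theorem isClosed_powerSet (P : ℝ) : IsClosed (powerSet P : Set (Matrix n n ℂ)) := by
  have e : (powerSet P : Set (Matrix n n ℂ)) = {Q | Qᴴ = Q} ∩
      (⋂ v : n → ℂ, {Q | 0 ≤ star v ⬝ᵥ Q *ᵥ v}) ∩ {Q | Q.trace.re ≤ P} := by
    ext Q
    simp only [powerSet, Matrix.posSemidef_iff_dotProduct_mulVec, Set.mem_inter_iff,
      Set.mem_iInter, Set.mem_ofPred_eq, Matrix.IsHermitian]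
  rw [e]
  refine ((isClosed_eq (by fun_prop) continuous_id).inter (isClosed_iInter fun v => ?_)).inter
    (isClosed_le (by fun_prop) continuous_const)
  exact isClosed_le continuous_const (by fun_prop)

theorem isCompact_powerSet (P : ℝ) : IsCompact (powerSet P : Set (Matrix n n ℂ)) := by
  have : ProperSpace (Matrix n n ℂ) := FiniteDimensional.proper ℂ _
  refine Metric.isCompact_of_isClosed_isBounded (isClosed_powerSet P) ?_
  exact isBounded_iff_forall_norm_le.mpr ⟨P, fun Q hQ => frobNorm_le_of_mem_powerSet hQ⟩

/-- Banach's fixed point theorem for the Frobenius norm on covariance matrices. -/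
theorem exists_fixedPoint_of_frobNorm_le {P K : ℝ} (hP : 0 ≤ P) (hK0 : 0 ≤ K) (hK : K < 1)
    {f : Matrix n n ℂ → Matrix n n ℂ} (hf : Set.MapsTo f (powerSet P) (powerSet P))
    (hlip : ∀ A ∈ powerSet P, ∀ B ∈ powerSet P, frobNorm (f A - f B) ≤ K * frobNorm (A - B)) :
    ∃ A ∈ powerSet P, f A = A := by
  have hc : ContractingWith ⟨K, hK0⟩ (hf.restrict f _ _) := by
    refine ⟨hK, LipschitzWith.of_dist_le_mul fun A B => ?_⟩
    rw [Subtype.dist_eq, Subtype.dist_eq, dist_eq_norm, dist_eq_norm]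
    exact hlip A A.2 B B.2
  obtain ⟨A, hA, hfix, -⟩ := hc.exists_fixedPoint' (isCompact_powerSet P).isComplete hf
    (zero_mem_powerSet hP) (edist_ne_top _ _)
  exact ⟨A, hA, hfix⟩

end Frobenius

variable [DecidableEq n]

theorem exists_isRateMax {G : Matrix n n ℂ} {P : ℝ} (hG : G.PosSemidef) (hP : 0 ≤ P) :
    ∃ S, IsRateMax G P S := by
  have hc : ContinuousOn (fun S : Matrix n n ℂ => Real.log (Matrix.det (1 + G * S)).re)
      (powerSet P) := by
    refine ContinuousOn.log (Continuous.continuousOn (by fun_prop)) fun S hS => ?_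
    exact (Complex.lt_def.mp (det_one_add_mul_pos hG hS.1)).1.ne'
  obtain ⟨S, hS, hmax⟩ := (isCompact_powerSet P).exists_isMaxOn ⟨0, zero_mem_powerSet hP⟩ hc
  exact ⟨S, hS, fun S' hS' => hmax hS'⟩

end Existence

/-! ### Dependence of the generalized inverse on the noise covariance -/

section WeightedPinv

variable {m n : Type*} [Fintype m] [Fintype n] [DecidableEq m]

theorem eq_zero_of_conjTranspose_mul_posDef_mul {l : Type*} {W : Matrix m m ℂ}
    (hW : W.PosDef) {Z : Matrix m l ℂ} (h : Zᴴ * W * Z = 0) : Z = 0 := by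
  obtain ⟨C, hC⟩ := exists_eq_conjTranspose_mul_self hW.posSemidef
  have h1 : C * Z = 0 := by
    rw [← Matrix.conjTranspose_mul_self_eq_zero, ← h, hC, Matrix.conjTranspose_mul]
    simp only [Matrix.mul_assoc]
  have h2 : W * Z = 0 := by rw [hC, Matrix.mul_assoc, h1, Matrix.mul_zero]
  rw [← Matrix.nonsing_inv_mul_cancel_left (A := W) Z (isUnit_iff_ne_zero.mpr hW.det_pos.ne'), h2,
    Matrix.mul_zero]

theorem IsMoorePenrose.mul_eq_one_of_rank {A : Matrix m n ℂ} {X : Matrix n m ℂ}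
    (h : IsMoorePenrose A X) (hr : A.rank = Fintype.card m) : A * X = 1 := by
  have htop : LinearMap.range A.mulVecLin = ⊤ :=
    Submodule.eq_top_of_finrank_eq (by rw [Module.finrank_fintype_fun_eq_card]; exact hr)
  refine Matrix.ext_of_mulVec_single fun i => ?_
  obtain ⟨w, hw⟩ := LinearMap.range_eq_top.mp htop (Pi.single i 1)
  rw [Matrix.mulVecLin_apply] at hw
  rw [← hw, Matrix.mulVec_mulVec, h.mul_mul_self, Matrix.one_mulVec]

/-- The effective gain matrix of a channel `H` of power gain `a` with noise covariance `C`. -/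
noncomputable def gain (a : ℝ) (H : Matrix m n ℂ) (C : Matrix m m ℂ) : Matrix n n ℂ :=
  (a : ℂ) • (Hᴴ * C⁻¹ * H)

/-- The weighted generalized inverse of `H` for the noise covariance `C`: the linear map that takes
a received signal to its Gauss-Markov (best linear unbiased) estimate. -/
noncomputable def weightedPinv (a : ℝ) (H : Matrix m n ℂ) (C : Matrix m m ℂ) : Matrix n m ℂ :=
  (a : ℂ) • (pinv (gain a H C) * Hᴴ * C⁻¹)

variable {a : ℝ} {H : Matrix m n ℂ} {C C₁ C₂ : Matrix m m ℂ}

theorem gain_posSemidef (ha : 0 < a) (hC : C.PosDef) : (gain a H C).PosSemidef :=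
  (hC.inv.posSemidef.conjTranspose_mul_mul_same H).smul (by exact_mod_cast ha.le)

theorem gain_ne_zero (ha : 0 < a) (hC : C.PosDef) (hH : H ≠ 0) : gain a H C ≠ 0 := by
  intro h0
  rcases smul_eq_zero.mp h0 with h | h
  · exact ha.ne' (Complex.ofReal_eq_zero.mp h)
  · exact hH (eq_zero_of_conjTranspose_mul_posDef_mul hC.inv h)

theorem weightedPinv_mul : weightedPinv a H C * H = pinv (gain a H C) * gain a H C := by
  calc weightedPinv a H C * H = pinv (gain a H C) * ((a : ℂ) • (Hᴴ * C⁻¹ * H)) := by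
        simp only [weightedPinv, Matrix.smul_mul, Matrix.mul_smul, Matrix.mul_assoc]
    _ = _ := by rw [← gain]

theorem mul_pinv_gain_mul_gain [DecidableEq n] (ha : 0 < a) (hC : C.PosDef) :
    H * (pinv (gain a H C) * gain a H C) = H := by
  have hX := pinv_spec (gain a H C)
  set Z := pinv (gain a H C) * gain a H C - 1 with hZ
  have hGZ : gain a H C * Z = 0 := by
    rw [hZ, Matrix.mul_sub, Matrix.mul_one, ← Matrix.mul_assoc, hX.mul_mul_self, sub_self]
  have h1 : (a : ℂ) • ((H * Z)ᴴ * C⁻¹ * (H * Z)) = 0 := by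
    calc (a : ℂ) • ((H * Z)ᴴ * C⁻¹ * (H * Z)) = Zᴴ * ((a : ℂ) • (Hᴴ * C⁻¹ * H) * Z) := by
          simp only [Matrix.conjTranspose_mul, Matrix.smul_mul, Matrix.mul_smul, Matrix.mul_assoc]
      _ = 0 := by rw [← gain, hGZ, Matrix.mul_zero]
  have h2 := eq_zero_of_conjTranspose_mul_posDef_mul hC.inv
    ((smul_eq_zero.mp h1).resolve_left (Complex.ofReal_ne_zero.mpr ha.ne'))
  rwa [hZ, Matrix.mul_sub, Matrix.mul_one, sub_eq_zero] at h2

/-- The projection onto the range of the gain matrix does not depend on the noise. -/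
theorem pinv_gain_mul_gain [DecidableEq n] (ha : 0 < a) (hC : C.PosDef) :
    pinv (gain a H C) * gain a H C = pinv H * H := by
  have hq := (pinv_spec (gain a H C)).isHermitian_right
  have hp := (pinv_spec H).isHermitian_right
  have h1 : pinv H * H * (pinv (gain a H C) * gain a H C) = pinv H * H := by
    rw [Matrix.mul_assoc, mul_pinv_gain_mul_gain ha hC]
  have h2 : pinv (gain a H C) * gain a H C * (pinv H * H) = pinv (gain a H C) * gain a H C := by
    rw [← weightedPinv_mul, Matrix.mul_assoc, ← Matrix.mul_assoc H, (pinv_spec H).mul_mul_self]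
  have h3 := congrArg Matrix.conjTranspose h1
  rw [Matrix.conjTranspose_mul, hq.eq, hp.eq, h2] at h3
  exact h3

/-- A resolvent identity for the generalized inverses of two gain matrices of the same channel: it
makes their difference linear in the difference of the noise covariances. -/
theorem pinv_gain_sub_pinv_gain [DecidableEq n] (ha : 0 < a) (h₁ : C₁.PosDef) (h₂ : C₂.PosDef) :
    pinv (gain a H C₁) - pinv (gain a H C₂) =
      ((a⁻¹ : ℝ) : ℂ) • (weightedPinv a H C₁ * (C₁ - C₂) * (weightedPinv a H C₂)ᴴ) := by
  have hX₁ := pinv_spec (gain a H C₁)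
  have hX₂ := pinv_spec (gain a H C₂)
  have hG₁ := (gain_posSemidef (H := H) ha h₁).1
  have hG₂ := (gain_posSemidef (H := H) ha h₂).1
  have hp : pinv (gain a H C₁) * gain a H C₁ = pinv (gain a H C₂) * gain a H C₂ := by
    rw [pinv_gain_mul_gain ha h₁, pinv_gain_mul_gain ha h₂]
  have e₁ : pinv (gain a H C₁) * (gain a H C₂ * pinv (gain a H C₂)) = pinv (gain a H C₁) := by
    rw [hX₂.mul_comm hG₂, ← hp, ← hX₁.mul_comm hG₁, ← Matrix.mul_assoc, hX₁.self_mul_mul]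
  have e₂ : pinv (gain a H C₁) * gain a H C₁ * pinv (gain a H C₂) = pinv (gain a H C₂) := by
    rw [hp, hX₂.self_mul_mul]
  have hX₂h := (hX₂.isHermitian hG₂).eq
  set X₁ := pinv (gain a H C₁) with hX₁d
  set X₂ := pinv (gain a H C₂) with hX₂d
  have hu₁ : IsUnit C₁.det := isUnit_iff_ne_zero.mpr h₁.det_pos.ne'
  have hu₂ : IsUnit C₂.det := isUnit_iff_ne_zero.mpr h₂.det_pos.ne'
  have hinv : C₂⁻¹ - C₁⁻¹ = C₁⁻¹ * (C₁ - C₂) * C₂⁻¹ := by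
    rw [Matrix.mul_sub, Matrix.sub_mul, Matrix.nonsing_inv_mul _ hu₁, Matrix.one_mul,
      Matrix.mul_assoc, Matrix.mul_nonsing_inv _ hu₂, Matrix.mul_one]
  have hL₂ : (weightedPinv a H C₂)ᴴ = (a : ℂ) • (C₂⁻¹ * (H * X₂)) := by
    rw [weightedPinv, Matrix.conjTranspose_smul, Matrix.conjTranspose_mul,
      Matrix.conjTranspose_mul, Matrix.conjTranspose_conjTranspose, ← hX₂d, hX₂h,
      h₂.inv.isHermitian.eq, Complex.star_def, Complex.conj_ofReal]
  calc X₁ - X₂ = X₁ * (gain a H C₂ * X₂) - X₁ * gain a H C₁ * X₂ := by rw [e₁, e₂]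
    _ = (a : ℂ) • (X₁ * Hᴴ * (C₂⁻¹ - C₁⁻¹) * (H * X₂)) := by
      simp only [gain, Matrix.smul_mul, Matrix.mul_smul, Matrix.mul_sub, Matrix.sub_mul,
        Matrix.mul_assoc, smul_sub]
    _ = _ := by
      rw [hinv, hL₂, weightedPinv, ← hX₁d]
      simp only [Matrix.smul_mul, Matrix.mul_smul, smul_smul, Matrix.mul_assoc]
      congr 1
      have : (a : ℂ) ≠ 0 := Complex.ofReal_ne_zero.mpr ha.ne'
      push_cast
      field_simp

/-- A channel of full row rank leaves nothing to estimate: the noise does not affect the weighted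
generalized inverse. -/
theorem weightedPinv_eq_pinv [DecidableEq n] (ha : 0 < a) (hC : C.PosDef)
    (hr : H.rank = Fintype.card m) : weightedPinv a H C = pinv H := by
  have h1 := (pinv_spec H).mul_eq_one_of_rank hr
  calc weightedPinv a H C = weightedPinv a H C * H * pinv H := by
        rw [Matrix.mul_assoc, h1, Matrix.mul_one]
    _ = pinv H := by
        rw [weightedPinv_mul, pinv_gain_mul_gain ha hC, (pinv_spec H).self_mul_mul]

open scoped Matrix.Norms.L2Operator in
/-- The Gauss-Markov theorem: the error covariance `L C Lᴴ` of the weighted generalized inverse `L`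
is at most the one of the unweighted inverse. When the noise covariance `C` is at least the
identity this bounds the norm of `L`. -/
theorem norm_weightedPinv_sq_le [DecidableEq n] (ha : 0 < a) (hC : C.PosDef)
    (hC1 : (C - 1).PosSemidef) : ‖weightedPinv a H C‖ ^ 2 ≤ ‖C‖ * ‖pinv H‖ ^ 2 := by
  have hLH : weightedPinv a H C * H = pinv H * H := by
    rw [weightedPinv_mul, pinv_gain_mul_gain ha hC]
  have hLC : C * (weightedPinv a H C)ᴴ = (a : ℂ) • (H * pinv (gain a H C)) := by
    rw [weightedPinv, Matrix.conjTranspose_smul, Matrix.conjTranspose_mul,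
      Matrix.conjTranspose_mul, Matrix.conjTranspose_conjTranspose,
      ((pinv_spec (gain a H C)).isHermitian (gain_posSemidef ha hC).1).eq,
      hC.inv.isHermitian.eq, Complex.star_def, Complex.conj_ofReal, Matrix.mul_smul,
      Matrix.mul_nonsing_inv_cancel_left _ _ (isUnit_iff_ne_zero.mpr hC.det_pos.ne')]
  set L := weightedPinv a H C
  set K := pinv H
  have hcross : (K - L) * C * Lᴴ = 0 := by
    rw [Matrix.mul_assoc, hLC, Matrix.mul_smul, ← Matrix.mul_assoc, Matrix.sub_mul, hLH, sub_self,
      Matrix.zero_mul, smul_zero]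
  have hcross' : L * C * (K - L)ᴴ = 0 := by
    have := congrArg Matrix.conjTranspose hcross
    simpa only [Matrix.conjTranspose_mul, Matrix.conjTranspose_conjTranspose,
      Matrix.conjTranspose_zero, hC.isHermitian.eq, ← Matrix.mul_assoc] using this
  have e : K * C * Kᴴ - L * Lᴴ = (K - L) * C * (K - L)ᴴ + L * (C - 1) * Lᴴ := by
    have h1 : K * C * Kᴴ = (K - L) * C * (K - L)ᴴ + (K - L) * C * Lᴴ + L * C * (K - L)ᴴ
        + L * C * Lᴴ := by
      rw [Matrix.conjTranspose_sub]
      simp only [Matrix.mul_sub, Matrix.sub_mul]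
      abel
    rw [h1, hcross, hcross', add_zero, add_zero, Matrix.mul_sub L, Matrix.mul_one,
      Matrix.sub_mul (L * C), add_sub_assoc]
  have hpsd : (K * C * Kᴴ - L * Lᴴ).PosSemidef := by
    rw [e]
    exact (hC.posSemidef.mul_mul_conjTranspose_same _).add (hC1.mul_mul_conjTranspose_same _)
  have h2 := norm_le_of_posSemidef_sub (Matrix.posSemidef_self_mul_conjTranspose L) hpsd
  have h3 : ‖L * Lᴴ‖ = ‖L‖ ^ 2 := by
    have := Matrix.l2_opNorm_conjTranspose_mul_self Lᴴ
    rwa [Matrix.conjTranspose_conjTranspose, Matrix.l2_opNorm_conjTranspose, ← sq] at this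
  rw [h3] at h2
  calc ‖L‖ ^ 2 ≤ ‖K * C * Kᴴ‖ := h2
    _ ≤ ‖K‖ * ‖C‖ * ‖Kᴴ‖ := (Matrix.l2_opNorm_mul _ _).trans (by
        gcongr; exact Matrix.l2_opNorm_mul _ _)
    _ = ‖C‖ * ‖K‖ ^ 2 := by rw [Matrix.l2_opNorm_conjTranspose]; ring

end WeightedPinv

/-! ### Best responses in the full-duplex channel -/

theorem other_other (i : Fin 2) : other (other i) = i := by
  fin_cases i <;> rfl

namespace Channel

variable {M N : ℕ} (c : Channel M N)

theorem noiseCov_sub_one_posSemidef {i : Fin 2} (hβ : 0 ≤ c.β) (hη : 0 < c.η i i)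
    {Q : Matrix (Fin M) (Fin M) ℂ} (hQ : Q.PosSemidef) : (c.noiseCov i Q - 1).PosSemidef := by
  rw [noiseCov, add_sub_cancel_left]
  have hd : (Matrix.diagonal Q.diag).PosSemidef :=
    Matrix.PosSemidef.diagonal fun k => hQ.diag_nonneg
  exact (hd.mul_mul_conjTranspose_same _).smul (by exact_mod_cast mul_nonneg hβ hη.le)

theorem noiseCov_posDef {i : Fin 2} (hβ : 0 ≤ c.β) (hη : 0 < c.η i i)
    {Q : Matrix (Fin M) (Fin M) ℂ} (hQ : Q.PosSemidef) : (c.noiseCov i Q).PosDef := by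
  have := posDef_one_add (c.noiseCov_sub_one_posSemidef hβ hη hQ)
  rwa [add_sub_cancel] at this

theorem noiseCov_sub_noiseCov (i : Fin 2) (Q Q' : Matrix (Fin M) (Fin M) ℂ) :
    c.noiseCov i Q - c.noiseCov i Q' = ((c.β * c.η i i : ℝ) : ℂ) •
      (c.H i i * Matrix.diagonal (Q - Q').diag * (c.H i i)ᴴ) := by
  have e : Matrix.diagonal (Q - Q').diag = Matrix.diagonal Q.diag - Matrix.diagonal Q'.diag := by
    rw [Matrix.diag_sub, Matrix.diagonal_sub]
    rfl
  rw [e, noiseCov, noiseCov, Matrix.mul_sub, Matrix.sub_mul, smul_sub]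
  abel

/-- The best responses are the maximizers of the rate for the effective gain matrix that the
strategy of the other node brings about. -/
theorem isBestResponse_iff {i : Fin 2} {T S : Matrix (Fin M) (Fin M) ℂ} :
    c.IsBestResponse i T S ↔ IsRateMax
      (gain (c.η i (other i)) (c.H i (other i)) (c.noiseCov (other i) T)) (c.P i) S := by
  simp only [IsBestResponse, IsRateMax, rate, gain, Matrix.smul_mul]
  rfl

theorem isNash_iff {Q : Profile M} :
    c.IsNash Q ↔ ∀ i, c.IsBestResponse i (Q (other i)) (Q i) :=
  ⟨fun h i => ⟨h.1 i, h.2 i⟩, fun h => ⟨fun i => (h i).1, fun i => (h i).2⟩⟩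

theorem rho_nonneg {n : Type*} [Fintype n] [DecidableEq n] (A : Matrix n n ℂ) : 0 ≤ rho A :=
  ENNReal.toReal_nonneg

theorem α_nonneg (hβ : 0 ≤ c.β) (hP : ∀ i, 0 ≤ c.P i) (hη : ∀ i j, 0 < c.η i j) (i : Fin 2) :
    0 ≤ c.α i := by
  have hγ : 0 < c.γ i := div_pos (hη _ _) (hη _ _)
  have hr := fun A : Matrix (Fin M) (Fin M) ℂ => rho_nonneg A
  have hr' := fun A : Matrix (Fin N) (Fin N) ℂ => rho_nonneg A
  have := hP i
  have := hη i i
  unfold α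
  split_ifs
  · exact mul_nonneg (by positivity) (hr _)
  · have := hr ((c.H i i)ᴴ * c.H i i)
    exact mul_nonneg (by positivity) (hr' _)

open scoped Matrix.Norms.L2Operator

theorem norm_noiseCov_le {i : Fin 2} (hβ : 0 ≤ c.β) (hη : 0 < c.η i i)
    {Q : Matrix (Fin M) (Fin M) ℂ} (hQ : Q ∈ c.feasible i) :
    ‖c.noiseCov i Q‖ ≤ 1 + c.β * c.η i i * c.P i * ‖c.H i i‖ ^ 2 := by
  have h1 : ‖(1 : Matrix (Fin N) (Fin N) ℂ)‖ ≤ 1 := by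
    rw [← Matrix.diagonal_one, Matrix.l2_opNorm_diagonal]
    exact (pi_norm_le_iff_of_nonneg zero_le_one).mpr fun k => by simp
  have h2 : ‖c.H i i * Matrix.diagonal Q.diag * (c.H i i)ᴴ‖ ≤ ‖c.H i i‖ * c.P i * ‖c.H i i‖ := by
    refine (Matrix.l2_opNorm_mul _ _).trans ?_
    rw [Matrix.l2_opNorm_conjTranspose]
    gcongr
    refine (Matrix.l2_opNorm_mul _ _).trans ?_
    gcongr
    exact (norm_diagonal_diag_le_trace hQ.1).trans hQ.2
  have h3 : 0 ≤ c.β * c.η i i := mul_nonneg hβ hη.le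
  calc ‖c.noiseCov i Q‖ ≤ ‖(1 : Matrix (Fin N) (Fin N) ℂ)‖ + ‖((c.β * c.η i i : ℝ) : ℂ) •
        (c.H i i * Matrix.diagonal Q.diag * (c.H i i)ᴴ)‖ := norm_add_le _ _
    _ ≤ 1 + (c.β * c.η i i) * (‖c.H i i‖ * c.P i * ‖c.H i i‖) := by
      rw [norm_smul, Complex.norm_of_nonneg h3]
      gcongr
    _ = _ := by ring

/-- The best response of node `i` is Lipschitz in the strategy of the other node `j`, with the
constant `α j`. -/
theorem frobNorm_bestResponse_sub_le {i j : Fin 2} (hij : other i = j) (hji : other j = i)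
    (hβ : 0 ≤ c.β) (hP : ∀ i, 0 ≤ c.P i) (hη : ∀ i j, 0 < c.η i j) (hH : c.H i j ≠ 0)
    {T₁ T₂ S₁ S₂ : Matrix (Fin M) (Fin M) ℂ} (hT₁ : T₁ ∈ c.feasible j) (hT₂ : T₂ ∈ c.feasible j)
    (hS₁ : c.IsBestResponse i T₁ S₁) (hS₂ : c.IsBestResponse i T₂ S₂) :
    frobNorm (S₁ - S₂) ≤ c.α j * frobNorm (T₁ - T₂) := by
  rw [isBestResponse_iff, hij] at hS₁ hS₂
  have hC₁ := c.noiseCov_posDef hβ (hη j j) hT₁.1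
  have hC₂ := c.noiseCov_posDef hβ (hη j j) hT₂.1
  have ha := hη i j
  set a := c.η i j with ha_def
  set A := c.H i j with hA
  set J := c.H j j with hJ
  set L₁ := weightedPinv a A (c.noiseCov j T₁) with hL₁
  set L₂ := weightedPinv a A (c.noiseCov j T₂) with hL₂
  have hβa : 0 ≤ c.β * c.η j j / a := div_nonneg (mul_nonneg hβ (hη j j).le) ha.le
  have hX : frobNorm (S₁ - S₂) ≤
      c.β * c.η j j / a * (‖L₁ * J‖ * ‖L₂ * J‖ * frobNorm (T₁ - T₂)) := by
    refine (IsRateMax.frobNorm_sub_le (hP i) (gain_posSemidef ha hC₁) (gain_posSemidef ha hC₂)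
      (gain_ne_zero ha hC₁ hH) (gain_ne_zero ha hC₂ hH) (pinv_spec _) (pinv_spec _)
      (by rw [pinv_gain_mul_gain ha hC₁, pinv_gain_mul_gain ha hC₂]) hS₁ hS₂).trans ?_
    have e : pinv (gain a A (c.noiseCov j T₁)) - pinv (gain a A (c.noiseCov j T₂)) =
        ((c.β * c.η j j / a : ℝ) : ℂ) •
          (L₁ * J * Matrix.diagonal (T₁ - T₂).diag * (L₂ * J)ᴴ) := by
      rw [pinv_gain_sub_pinv_gain ha hC₁ hC₂, noiseCov_sub_noiseCov, Matrix.mul_smul,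
        Matrix.smul_mul, smul_smul, Matrix.conjTranspose_mul]
      simp only [Matrix.mul_assoc, ← hL₁, ← hL₂, ← hJ]
      congr 1
      push_cast
      ring
    rw [e, frobNorm_smul, Complex.norm_of_nonneg hβa]
    gcongr
    refine (frobNorm_mul_mul_conjTranspose_le _ _ _).trans ?_
    gcongr
    exact frobNorm_diagonal_diag_le _
  refine hX.trans ?_
  rw [← mul_assoc]
  refine mul_le_mul_of_nonneg_right ?_ (frobNorm_nonneg _)
  have hγ : c.β / c.γ j = c.β * c.η j j / a := by
    rw [γ, hji, div_div_eq_mul_div]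
  rw [α, hγ, hji, ← hA, ← hJ]
  split_ifs with hr
  · have hr' : A.rank = Fintype.card (Fin N) := by rw [hr, Fintype.card_fin]
    rw [hL₁, hL₂, weightedPinv_eq_pinv ha hC₁ hr', weightedPinv_eq_pinv ha hC₂ hr']
    have e : Jᴴ * (pinv A)ᴴ * pinv A * J = (pinv A * J)ᴴ * (pinv A * J) := by
      rw [Matrix.conjTranspose_mul]; simp only [Matrix.mul_assoc]
    rw [e, rho_conjTranspose_mul_self, sq]
  · rw [rho_conjTranspose_mul_self, rho_conjTranspose_mul_self]
    set s := 1 + c.β * c.η j j * c.P j * ‖J‖ ^ 2 with hs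
    have hPj := hP j
    have hηj := hη j j
    have hs0 : 0 ≤ s := by positivity
    have hL : ∀ T ∈ c.feasible j, ‖weightedPinv a A (c.noiseCov j T) * J‖ ≤
        √s * ‖pinv A‖ * ‖J‖ := by
      intro T hT
      refine (Matrix.l2_opNorm_mul _ _).trans ?_
      gcongr
      refine le_of_sq_le_sq ?_ (by positivity)
      rw [mul_pow, Real.sq_sqrt hs0]
      refine (norm_weightedPinv_sq_le ha (c.noiseCov_posDef hβ hηj hT.1)
        (c.noiseCov_sub_one_posSemidef hβ hηj hT.1)).trans ?_
      gcongr
      exact c.norm_noiseCov_le hβ hηj hT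
    calc c.β * c.η j j / a * (‖L₁ * J‖ * ‖L₂ * J‖)
        ≤ c.β * c.η j j / a * ((√s * ‖pinv A‖ * ‖J‖) * (√s * ‖pinv A‖ * ‖J‖)) := by
          gcongr
          · exact hL T₁ hT₁
          · exact hL T₂ hT₂
      _ = c.β * c.η j j / a * (√s ^ 2 * ‖J‖ ^ 2 * ‖pinv A‖ ^ 2) := by ring
      _ = c.β * c.η j j / a * s * ‖J‖ ^ 2 * ‖pinv A‖ ^ 2 := by rw [Real.sq_sqrt hs0]; ring

end Channel

/-- Weights for the max norm: two Lipschitz constants with product below `1`, one for either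
component, are balanced by rescaling the components. -/
theorem exists_weights {x y : ℝ} (hx : 0 ≤ x) (hy : 0 ≤ y) (hxy : x * y < 1) :
    ∃ u v κ : ℝ, 0 < u ∧ 0 < v ∧ 0 ≤ κ ∧ κ < 1 ∧ y * v ≤ κ * u ∧ x * u ≤ κ * v := by
  -- The constants are enlarged to `x + ε` and `y + ε`, to be positive; the weights are the square
  -- roots of `y + ε` and `x + ε`.
  obtain ⟨ε, hε, hlt⟩ : ∃ ε : ℝ, 0 < ε ∧ (x + ε) * (y + ε) < 1 := by
    have hc : Continuous fun ε : ℝ => (x + ε) * (y + ε) := by fun_prop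
    have h := (hc.tendsto 0).mono_left (nhdsWithin_le_nhds (s := Set.Ioi 0))
    simp only [add_zero] at h
    obtain ⟨ε, h1, h2⟩ := ((h.eventually_lt_const hxy).and self_mem_nhdsWithin).exists
    exact ⟨ε, h2, h1⟩
  have hx' : 0 < x + ε := by linarith
  have hy' : 0 < y + ε := by linarith
  refine ⟨√(y + ε), √(x + ε), √(x + ε) * √(y + ε), Real.sqrt_pos.mpr hy', Real.sqrt_pos.mpr hx',
    by positivity, ?_, ?_, ?_⟩
  · rw [← Real.sqrt_mul hx'.le, Real.sqrt_lt' one_pos]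
    simpa using hlt
  · rw [mul_assoc, Real.mul_self_sqrt hy'.le, mul_comm]
    gcongr
    linarith
  · rw [mul_right_comm, Real.mul_self_sqrt hx'.le]
    gcongr
    linarith

end FullDuplex

theorem theorem2 {M N : ℕ} (c : FullDuplex.Channel M N)
    (hβ : 0 ≤ c.β) (hP : ∀ i, 0 ≤ c.P i) (hη : ∀ i j, 0 < c.η i j)
    (hH : ∀ i, c.H i (FullDuplex.other i) ≠ 0)
    (hα : c.α 0 * c.α 1 < 1) :
    (∃! Q : FullDuplex.Profile M, c.IsNash Q) ∧
      ∃ Φ : FullDuplex.Profile M → FullDuplex.Profile M, c.IsBestResponseMap Φ ∧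
        ∃ w : Fin 2 → ℝ, (∀ i, 0 < w i) ∧ c.IsContraction w Φ := by
  open FullDuplex in
  have hex : ∀ i T, ∃ S, T ∈ c.feasible (other i) → c.IsBestResponse i T S := by
    intro i T
    by_cases hT : T ∈ c.feasible (other i)
    · obtain ⟨S, hS⟩ := exists_isRateMax (gain_posSemidef (H := c.H i (other i)) (hη i (other i))
        (c.noiseCov_posDef hβ (hη _ _) hT.1)) (hP i)
      exact ⟨S, fun _ => c.isBestResponse_iff.mpr hS⟩
    · exact ⟨0, fun h => absurd h hT⟩
  choose B hB using hex
  have hlip : ∀ i, ∀ T₁ ∈ c.feasible (other i), ∀ T₂ ∈ c.feasible (other i), ∀ S₁ S₂,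
      c.IsBestResponse i T₁ S₁ → c.IsBestResponse i T₂ S₂ →
      frobNorm (S₁ - S₂) ≤ c.α (other i) * frobNorm (T₁ - T₂) :=
    fun i T₁ h₁ T₂ h₂ S₁ S₂ hS₁ hS₂ =>
      c.frobNorm_bestResponse_sub_le rfl (other_other i) hβ hP hη (hH i) h₁ h₂ hS₁ hS₂
  have huniq : ∀ i, ∀ T ∈ c.feasible (other i), ∀ S, c.IsBestResponse i T S → S = B i T := by
    intro i T hT S hS
    refine eq_of_frobNorm_sub (le_antisymm ?_ (frobNorm_nonneg _))
    have := hlip i T hT T hT S _ hS (hB i T hT)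
    rwa [sub_self, frobNorm_zero, mul_zero] at this
  have hα0 := c.α_nonneg hβ hP hη 0
  have hα1 := c.α_nonneg hβ hP hη 1
  have h01 : other 0 = 1 := rfl
  have h10 : other 1 = 0 := rfl
  have hB0 : ∀ T ∈ c.feasible 1, c.IsBestResponse 0 T (B 0 T) := hB 0
  have hB1 : ∀ T ∈ c.feasible 0, c.IsBestResponse 1 T (B 1 T) := hB 1
  refine ⟨?_, fun Q i => B i (Q (other i)), ?_, ?_⟩
  -- An equilibrium is a fixed point of the composition of the two best responses.
  · have hcomp : ∀ T₁ ∈ c.feasible 0, ∀ T₂ ∈ c.feasible 0,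
        frobNorm (B 0 (B 1 T₁) - B 0 (B 1 T₂)) ≤ c.α 0 * c.α 1 * frobNorm (T₁ - T₂) := by
      intro T₁ h₁ T₂ h₂
      have e0 := hlip 0 _ (hB1 T₁ h₁).1 _ (hB1 T₂ h₂).1 _ _ (hB0 _ (hB1 T₁ h₁).1)
        (hB0 _ (hB1 T₂ h₂).1)
      have e1 := hlip 1 _ h₁ _ h₂ _ _ (hB1 T₁ h₁) (hB1 T₂ h₂)
      rw [h01] at e0
      rw [h10] at e1
      calc _ ≤ c.α 1 * frobNorm (B 1 T₁ - B 1 T₂) := e0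
        _ ≤ c.α 1 * (c.α 0 * frobNorm (T₁ - T₂)) := by gcongr
        _ = _ := by ring
    obtain ⟨q, hq, hfix⟩ := exists_fixedPoint_of_frobNorm_le (hP 0) (mul_nonneg hα0 hα1) hα
      (f := fun T => B 0 (B 1 T)) (fun T hT => (hB0 _ (hB1 T hT).1).1) hcomp
    refine ⟨![q, B 1 q], ?_, ?_⟩
    · refine c.isNash_iff.mpr (Fin.forall_fin_two.mpr ⟨?_, hB1 q hq⟩)
      have := hB0 _ (hB1 q hq).1
      rwa [hfix] at this
    · intro Q hQ
      have hQf := hQ.1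
      have hbr := c.isNash_iff.mp hQ
      have e1 : Q 1 = B 1 (Q 0) := huniq 1 _ (hQf 0) _ (hbr 1)
      have e0 : Q 0 = B 0 (B 1 (Q 0)) := by
        rw [← e1]
        exact huniq 0 _ (hQf 1) _ (hbr 0)
      have e : Q 0 = q := by
        have h := hcomp _ (hQf 0) _ hq
        rw [← e0, show B 0 (B 1 q) = q from hfix] at h
        refine eq_of_frobNorm_sub (le_antisymm ?_ (frobNorm_nonneg _))
        nlinarith [frobNorm_nonneg (Q 0 - q)]
      funext i
      fin_cases i
      · exact e
      · exact e1.trans (by rw [e]; rfl)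
  · intro Q hQ Q'
    refine ⟨fun h => funext fun i => huniq i _ (hQ _) _ (h i), ?_⟩
    rintro rfl i
    exact hB i _ (hQ _)
  · obtain ⟨u, v, κ, hu, hv, hκ0, hκ1, huv, hvu⟩ := exists_weights hα0 hα1 hα
    refine ⟨![u, v], Fin.forall_fin_two.mpr ⟨hu, hv⟩, κ, hκ0, hκ1, fun Q Q' hQ hQ' => ?_⟩
    have e0 := hlip 0 _ (hQ 1) _ (hQ' 1) _ _ (hB0 _ (hQ 1)) (hB0 _ (hQ' 1))
    have e1 := hlip 1 _ (hQ 0) _ (hQ' 0) _ _ (hB1 _ (hQ 0)) (hB1 _ (hQ' 0))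
    set m := weightedMaxNorm ![u, v] (Q - Q') with hm
    have m0 : frobNorm (Q 0 - Q' 0) ≤ m * u := (div_le_iff₀ hu).mp (le_max_left _ _)
    have m1 : frobNorm (Q 1 - Q' 1) ≤ m * v := (div_le_iff₀ hv).mp (le_max_right _ _)
    have hm0 : 0 ≤ m := nonneg_of_mul_nonneg_left ((frobNorm_nonneg _).trans m0) hu
    refine max_le ((div_le_iff₀ hu).mpr ?_) ((div_le_iff₀ hv).mpr ?_)
    · calc _ ≤ c.α 1 * frobNorm (Q 1 - Q' 1) := e0
        _ ≤ c.α 1 * (m * v) := by gcongr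
        _ = m * (c.α 1 * v) := by ring
        _ ≤ m * (κ * u) := by gcongr
        _ = κ * m * u := by ring
    · calc _ ≤ c.α 0 * frobNorm (Q 0 - Q' 0) := e1
        _ ≤ c.α 0 * (m * u) := by gcongr
        _ = m * (c.α 0 * u) := by ring
        _ ≤ m * (κ * v) := by gcongr
        _ = κ * m * v := by ring
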